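/- Let $(R,\mathfrak m)$ be an excellent local ring (that is, $R$ is a Noetherian local ring which is universally catenary, whose formal fibres are geometrically regular, and such that every finitely generated $R$-algebra has an open regular locus), let $M$ be a finitely generated $R$-module, and let $\widehat{\ast}$ denote $\mathfrak m$-adic completion. For a finitely generated module $N$ over a Noetherian ring $S$, let $\mathrm{ir}_S(N)$ denote its reducibility index, i.e. the number of irreducible submodules in an irredundant decomposition of the zero submodule of $N$ as a finite intersection of irreducible submodules (this number does not depend on the decomposition, and it is $0$ for $N=0$). Then the following statements are equivalent: (a) $\mathrm{ir}_R(M)=\mathrm{ir}_{\widehat R}(\widehat M)$; (b) $\mathfrak p\widehat R$ is a prime ideal of $\widehat R$ for every $\mathfrak p\in\mathrm{Ass}_R(M)$. -/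

import Mathlib

open scoped TensorProduct

universe u v

section ReducibilityIndex

variable {R : Type u} {M : Type v} [CommRing R] [AddCommGroup M] [Module R M]

/-- A finite set `t` of submodules of `M` is an irredundant irreducible decomposition of `N`:
every member of `t` is irreducible (it is proper, and it is not the intersection of two strictly
larger submodules), the members of `t` intersect in `N`, and no member of `t` can be left out.
The empty set decomposes `N = M`. -/
structure Submodule.IsIrredundantIrreducibleDecomposition
    (N : Submodule R M) (t : Finset (Submodule R M)) : Prop where
  irreducible : ∀ J ∈ t, InfIrred J
  inf_eq : t.inf id = N
  irredundant : ∀ s : Finset (Submodule R M), s ⊂ t → s.inf id ≠ N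

/-- The reducibility index of `N` in `M`: the number of submodules in an irredundant irreducible
decomposition of `N`. For a Noetherian module such decompositions exist and all have the same
number of members, see `Submodule.exists_isIrredundantIrreducibleDecomposition` and
`Submodule.IsIrredundantIrreducibleDecomposition.card_eq_reducibilityIndex`. -/
noncomputable def Submodule.reducibilityIndex (N : Submodule R M) : ℕ :=
  sInf {n : ℕ | ∃ t : Finset (Submodule R M),
    N.IsIrredundantIrreducibleDecomposition t ∧ t.card = n}

variable (R M) in
/-- The reducibility index `ir_R(M)` of a module: the reducibility index of `0` in `M`. -/
noncomputable def Module.reducibilityIndex : ℕ :=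
  (⊥ : Submodule R M).reducibilityIndex

theorem Submodule.exists_isIrredundantIrreducibleDecomposition [IsNoetherian R M]
    (N : Submodule R M) :
    ∃ t : Finset (Submodule R M), N.IsIrredundantIrreducibleDecomposition t := by
  obtain ⟨t, ht, htN⟩ := exists_infIrred_decomposition N
  induction t using Finset.strongInduction with
  | H t ih =>
    by_cases h : ∃ s : Finset (Submodule R M), s ⊂ t ∧ s.inf id = N
    · obtain ⟨s, hs, hsN⟩ := h
      exact ih s hs hsN fun {J} hJ => htN (hs.1 hJ)
    · push Not at h
      exact ⟨t, fun J hJ => htN hJ, ht, h⟩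

/-- The exchange property of irreducible decompositions. -/
theorem Submodule.exists_inf_eq_of_infIrred {N x c : Submodule R M} (hx : InfIrred x)
    (hxc : x ⊓ c = N) {B : Finset (Submodule R M)} (hB : B.inf id = N) :
    ∃ y ∈ B, y ⊓ c = N := by
  have hNx : N ≤ x := hxc ▸ inf_le_left
  have hNc : N ≤ c := hxc ▸ inf_le_right
  have hNB : ∀ y ∈ B, N ≤ y := fun y hy => hB ▸ Finset.inf_le (f := id) hy
  have key : B.inf (fun y => x ⊔ c ⊓ y) = x := by
    refine le_antisymm ?_ (Finset.le_inf fun y _ => le_sup_left)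
    set z := B.inf (fun y => x ⊔ c ⊓ y) with hz
    have hxz : x ≤ z := Finset.le_inf fun y _ => le_sup_left
    have hzy : ∀ y ∈ B, z ≤ x ⊔ c ⊓ y := fun y hy => Finset.inf_le hy
    have hne : B.Nonempty := by
      rw [Finset.nonempty_iff_ne_empty]
      rintro rfl
      rw [Finset.inf_empty] at hB
      exact hx.ne_top (top_le_iff.1 (hB ▸ hNx))
    obtain ⟨y₀, hy₀⟩ := hne
    have hzc : z ≤ x ⊔ c := (hzy y₀ hy₀).trans (sup_le_sup_left inf_le_left x)
    have h1 : z ⊓ c ≤ N := by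
      rw [← hB]
      refine Finset.le_inf fun y hy => ?_
      have h2 : z ⊓ c ≤ (c ⊓ y ⊔ x) ⊓ c :=
        inf_le_inf_right c ((hzy y hy).trans_eq (sup_comm _ _))
      rw [sup_inf_assoc_of_le x (inf_le_left : c ⊓ y ≤ c), hxc] at h2
      exact h2.trans (sup_le inf_le_right (hNB y hy))
    calc z ≤ (x ⊔ c) ⊓ z := le_inf hzc le_rfl
      _ = x ⊔ c ⊓ z := sup_inf_assoc_of_le c hxz
      _ ≤ x := sup_le le_rfl ((inf_comm c z).le.trans (h1.trans hNx))
  obtain ⟨y, hy, hyx⟩ := hx.finset_inf_eq key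
  refine ⟨y, hy, le_antisymm ?_ (le_inf (hNB y hy) hNc)⟩
  rw [← hxc]
  exact le_inf ((inf_comm y c).le.trans (sup_eq_left.1 hyx)) inf_le_right

theorem Submodule.IsIrredundantIrreducibleDecomposition.card_le {N : Submodule R M}
    {t : Finset (Submodule R M)} (ht : N.IsIrredundantIrreducibleDecomposition t)
    (S : Finset (Submodule R M)) (hS : ∀ J ∈ S, InfIrred J) (hSN : S.inf id = N) :
    t.card ≤ S.card := by
  classical
  induction hn : (S \ t).card using Nat.strong_induction_on generalizing S with
  | _ n ih =>
    by_cases hSt : S ⊆ t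
    · rcases hSt.eq_or_ssubset with rfl | h
      · exact le_rfl
      · exact absurd hSN (ht.irredundant S h)
    · obtain ⟨x, hxS, hxt⟩ := Finset.not_subset.1 hSt
      have hxc : x ⊓ (S.erase x).inf id = N := by
        rw [← hSN, ← Finset.insert_erase hxS, Finset.inf_insert]
        simp
      obtain ⟨y, hy, hyN⟩ := Submodule.exists_inf_eq_of_infIrred (hS x hxS) hxc ht.inf_eq
      have hcard : (insert y (S.erase x)).card ≤ S.card := by
        refine (Finset.card_insert_le _ _).trans ?_
        rw [Finset.card_erase_add_one hxS]
      refine (ih _ ?_ (insert y (S.erase x)) ?_ ?_ rfl).trans hcard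
      · rw [← hn]
        refine Finset.card_lt_card (Finset.ssubset_iff_of_subset ?_ |>.2 ⟨x, ?_, ?_⟩)
        · intro J hJ
          simp only [Finset.mem_sdiff, Finset.mem_insert, Finset.mem_erase] at hJ ⊢
          obtain ⟨rfl | hJ, hJt⟩ := hJ
          · exact absurd hy hJt
          · exact ⟨hJ.2, hJt⟩
        · simp [hxS, hxt]
        · simp only [Finset.mem_sdiff, Finset.mem_insert, Finset.mem_erase]
          rintro ⟨rfl | h, -⟩
          · exact hxt hy
          · exact h.1 rfl
      · intro J hJ
        rcases Finset.mem_insert.1 hJ with rfl | hJ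
        · exact ht.irreducible _ hy
        · exact hS J (Finset.mem_of_mem_erase hJ)
      · rw [Finset.inf_insert]
        exact hyN

theorem Submodule.IsIrredundantIrreducibleDecomposition.card_eq_reducibilityIndex
    {N : Submodule R M} {t : Finset (Submodule R M)}
    (ht : N.IsIrredundantIrreducibleDecomposition t) : t.card = N.reducibilityIndex := by
  obtain ⟨s, hs, hsn⟩ := Nat.sInf_mem (s := {n : ℕ | ∃ t : Finset (Submodule R M),
    N.IsIrredundantIrreducibleDecomposition t ∧ t.card = n}) ⟨_, t, ht, rfl⟩
  unfold Submodule.reducibilityIndex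
  rw [← hsn]
  exact le_antisymm (ht.card_le s hs.irreducible hs.inf_eq)
    (hs.card_le t ht.irreducible ht.inf_eq)

end ReducibilityIndex

section Excellent

/-- An algebra `A` over a field `k` is geometrically regular if `L ⊗ A` is a (Noetherian) regular
ring for every finite field extension `L` of `k`. -/
def Algebra.IsGeometricallyRegular (k : Type u) (A : Type v) [Field k] [CommRing A]
    [Algebra k A] : Prop :=
  ∀ (L : Type u) [Field L] [Algebra k L] [FiniteDimensional k L], IsRegularRing (L ⊗[k] A)

/-- The structure map `A → B` is a regular homomorphism: it is flat, and for every prime `p` of `A`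
the fibre `κ(p) ⊗ B` is geometrically regular over the residue field `κ(p)`. -/
structure Algebra.IsRegularHom (A : Type u) (B : Type v) [CommRing A] [CommRing B]
    [Algebra A B] : Prop where
  flat : Module.Flat A B
  geometricallyRegular : ∀ (p : Ideal A) [p.IsPrime],
    Algebra.IsGeometricallyRegular p.ResidueField (p.Fiber B)

/-- The condition on formal fibres of a G-ring: for every prime `p` of `R`, the completion map
from the local ring of `R` at `p` is regular. -/
def HasGeometricallyRegularFormalFibers (R : Type u) [CommRing R] : Prop :=
  ∀ (p : Ideal R) [p.IsPrime], Algebra.IsRegularHom (Localization.AtPrime p)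
    (AdicCompletion (IsLocalRing.maximalIdeal (Localization.AtPrime p)) (Localization.AtPrime p))

/-- A ring is catenary if for all primes `p ≤ q` the lengths of the strict chains of primes from
`p` to `q` are bounded, and all saturated ones have the same length. -/
def IsCatenaryRing (R : Type u) [CommRing R] : Prop :=
  ∀ p q : PrimeSpectrum R, p ≤ q → ∃ n : ℕ,
    (∀ s : LTSeries (PrimeSpectrum R), s.head = p → s.last = q → s.length ≤ n) ∧
    (∀ s : RelSeries {x : PrimeSpectrum R × PrimeSpectrum R | x.1 ⋖ x.2},
      s.head = p → s.last = q → s.length = n)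

/-- The regular locus of `Spec R`. -/
def regularLocus (R : Type u) [CommRing R] : Set (PrimeSpectrum R) :=
  {p | IsRegularLocalRing (Localization.AtPrime p.asIdeal)}

/-- Excellent rings: Noetherian, universally catenary, with geometrically regular formal fibres
(G-ring), and such that every finitely generated algebra has an open regular locus (J-2). -/
class IsExcellentRing (R : Type u) [CommRing R] : Prop where
  isNoetherianRing : IsNoetherianRing R
  universallyCatenary : ∀ (S : Type u) [CommRing S] [Algebra R S] [Algebra.FiniteType R S],
    IsCatenaryRing S
  formalFibers : HasGeometricallyRegularFormalFibers R
  isOpen_regularLocus : ∀ (S : Type u) [CommRing S] [Algebra R S] [Algebra.FiniteType R S],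
    IsOpen (regularLocus S)

end Excellent

/-! Write S for the completion; it is faithfully flat over R. Regular local rings are domains, so
the formal fibres are reduced, and hence pS is radical for every prime p. The rest holds for any
faithfully flat S with pS radical for p in Ass(M).

Let 0 be the irredundant intersection of irreducible submodules N of M. Each N has an element b with
N : b in Ass(M), and every prime of Ass(M) arises so. As N is irreducible, N + Rb is essential over
N, and essentiality survives flat base change (`baseChange_lt_inf_of_essential`). Irreducibility of
S ⊗ N is thus decided inside S ⊗ (N + Rb)/N ≅ S/pS, where p = N : b. For radical pS, zero is
irreducible in S/pS exactly when pS is prime (`infIrred_baseChange`,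
`isPrime_map_of_infIrred_baseChange`).

If all pS are prime, the decomposition base changes to one of the same size. If some S ⊗ N splits,
replacing it by its two pieces gives a longer irredundant family, and by exchange the index of S ⊗ M
is strictly larger (`infIrred_baseChange_of_card_le`). -/

/-! ### Regular local rings are domains -/

/-- Since x lies outside the square of the maximal ideal, some minimal generator has a unit
coefficient in x and becomes redundant modulo x. -/
theorem IsLocalRing.spanFinrank_map_quotient_lt {R : Type*} [CommRing R] [IsLocalRing R]
    [IsNoetherianRing R] {x : R} (hx : x ∈ maximalIdeal R) (hx2 : x ∉ maximalIdeal R ^ 2) :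
    ((maximalIdeal R).map (Ideal.Quotient.mk (Ideal.span {x}))).spanFinrank + 1 ≤
      (maximalIdeal R).spanFinrank := by
  classical
  obtain ⟨s, hs, hsm⟩ :=
    (IsNoetherian.noetherian (maximalIdeal R)).exists_span_finset_card_eq_spanFinrank
  have hsub : ∀ b ∈ s, b ∈ maximalIdeal R := fun b hb => hsm ▸ Submodule.subset_span hb
  obtain ⟨f, -, hf⟩ := Submodule.mem_span_finset.1 (hsm.symm ▸ hx : x ∈ Submodule.span R (s : Set R))
  obtain ⟨a, ha, hfa⟩ : ∃ a ∈ s, f a ∉ maximalIdeal R := by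
    by_contra! h
    refine hx2 (hf ▸ Ideal.sum_mem _ fun a ha => ?_)
    rw [pow_two]
    exact Ideal.mul_mem_mul (h a ha) (hsub a ha)
  have hu : IsUnit (f a) := by simpa using hfa
  set π := Ideal.Quotient.mk (Ideal.span {x})
  have hle : (maximalIdeal R).map π ≤ Ideal.span (((s.erase a).image π : Finset _) : Set _) := by
    rw [← hsm, ← Ideal.span, Ideal.map_span, Ideal.span_le]
    rintro _ ⟨b, hb, rfl⟩
    have hmem : ∀ c ∈ s.erase a,
        π c ∈ Ideal.span (((s.erase a).image π : Finset _) : Set _) := fun c hc =>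
      Ideal.subset_span (Finset.mem_coe.2 (Finset.mem_image_of_mem π hc))
    by_cases hba : b = a
    · subst hba
      have h0 : π x = 0 := Ideal.Quotient.eq_zero_iff_mem.2 (Ideal.mem_span_singleton_self x)
      replace h0 := (congrArg π ((Finset.add_sum_erase s _ hb).trans hf)).trans h0
      rw [map_add, smul_eq_mul, map_mul, map_sum] at h0
      refine (Ideal.unit_mul_mem_iff_mem _ (hu.map π)).1 ?_
      rw [eq_neg_of_add_eq_zero_left h0]
      refine neg_mem (Ideal.sum_mem _ fun c hc => ?_)
      rw [smul_eq_mul, map_mul]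
      exact Ideal.mul_mem_left _ _ (hmem c hc)
    · exact hmem b (Finset.mem_erase.2 ⟨hba, hb⟩)
  have heq : (maximalIdeal R).map π = Ideal.span (((s.erase a).image π : Finset _) : Set _) := by
    refine le_antisymm hle (Ideal.span_le.2 ?_)
    intro y hy
    obtain ⟨c, hc, rfl⟩ := Finset.mem_image.1 (Finset.mem_coe.1 hy)
    exact Ideal.mem_map_of_mem π (hsub c (Finset.mem_of_mem_erase hc))
  rw [heq, ← hs, ← Finset.card_erase_add_one ha]
  gcongr
  refine (Submodule.spanFinrank_span_le_ncard_of_finite (Finset.finite_toSet _)).trans ?_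
  rw [Set.ncard_coe_finset]
  exact Finset.card_image_le

/-- Induction on embedding dimension. Prime avoidance gives x in m outside m² and all minimal
primes; R/(x) is regular of dimension one less, so (x) is prime. A minimal prime P inside (x)
satisfies P = xP, so P = 0 by Nakayama. -/
theorem IsRegularLocalRing.isDomain (R : Type*) [CommRing R] [IsRegularLocalRing R] :
    IsDomain R := by
  induction hd : (IsLocalRing.maximalIdeal R).spanFinrank generalizing R with
  | zero =>
    rw [Submodule.spanFinrank_eq_zero_iff_eq_bot (IsNoetherian.noetherian _)] at hd
    exact (IsLocalRing.isField_iff_maximalIdeal_eq.2 hd).isDomain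
  | succ d ih =>
    have hdim : ringKrullDim R = (d + 1 : ℕ) := by
      rw [← hd, IsRegularLocalRing.spanFinrank_maximalIdeal]
    set m := IsLocalRing.maximalIdeal R with hm
    obtain ⟨x, hxm, hx2, hxmin⟩ : ∃ x ∈ m, x ∉ m ^ 2 ∧ ∀ P ∈ minimalPrimes R, x ∉ P := by
      by_contra! h
      have hsub : (m : Set R) ⊆ ⋃ I ∈ insert (m ^ 2) (minimalPrimes R), (I : Set R) := by
        intro x hx
        by_cases hx2 : x ∈ m ^ 2
        · exact Set.mem_biUnion (Set.mem_insert _ _) hx2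
        · obtain ⟨P, hP, hxP⟩ := h x hx hx2
          exact Set.mem_biUnion (Set.mem_insert_of_mem _ hP) hxP
      -- Prime avoidance tolerates two non-prime ideals; m² fills both places.
      rw [Ideal.subset_union_prime_finite (f := fun I : Ideal R => I)
        ((minimalPrimes.finite_of_isNoetherianRing R).insert _) (m ^ 2) (m ^ 2)
        (fun I hI h1 _ => ((Set.mem_insert_iff.1 hI).resolve_left h1).1.1)] at hsub
      obtain ⟨I, rfl | hI, hmI⟩ := hsub
      · have h0 : m = ⊥ := by
          refine Submodule.eq_bot_of_le_smul_of_le_jacobson_bot m m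
            (IsNoetherian.noetherian _) ?_ (IsLocalRing.maximalIdeal_le_jacobson _)
          rwa [smul_eq_mul, ← pow_two]
        rw [(Submodule.spanFinrank_eq_zero_iff_eq_bot (IsNoetherian.noetherian m)).2 h0] at hd
        omega
      · have := hI.1.1
        have hIm : I = m := le_antisymm (IsLocalRing.le_maximalIdeal this.ne_top) hmI
        have h0 : m.height = 0 := by
          rw [← hIm]
          exact Ideal.height_eq_zero_iff.2 hI
        rw [← IsLocalRing.maximalIdeal_height_eq_ringKrullDim, ← hm, h0] at hdim
        norm_cast at hdim
    have hnt : Nontrivial (R ⧸ Ideal.span {x}) := Ideal.Quotient.nontrivial_iff.2 fun h =>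
      (Ideal.IsPrime.ne_top inferInstance : m ≠ ⊤)
        (top_le_iff.1 (h ▸ (Ideal.span_singleton_le_iff_mem _).2 hxm))
    have hloc : IsLocalRing (R ⧸ Ideal.span {x}) :=
      .of_surjective' _ Ideal.Quotient.mk_surjective
    have hmax : IsLocalRing.maximalIdeal (R ⧸ Ideal.span {x}) =
        m.map (Ideal.Quotient.mk (Ideal.span {x})) := by
      refine (IsLocalRing.map_maximalIdeal_of_surjective _ Ideal.Quotient.mk_surjective).symm
    have hlt := IsLocalRing.spanFinrank_map_quotient_lt hxm hx2
    rw [← hmax, ← hm, hd] at hlt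
    have hdimle : ringKrullDim R ≤ ringKrullDim (R ⧸ Ideal.span {x}) + 1 := by
      simpa using ringKrullDim_le_ringKrullDim_quotient_add_encard ({x} : Set R) (by
        rwa [IsLocalRing.ringJacobson_eq_maximalIdeal, Set.singleton_subset_iff])
    have hled : (d : WithBot ℕ∞) ≤ ringKrullDim (R ⧸ Ideal.span {x}) := by
      rw [hdim] at hdimle
      push_cast at hdimle
      generalize ringKrullDim (R ⧸ Ideal.span {x}) = D at hdimle
      induction D with
      | bot =>
        rw [WithBot.bot_add] at hdimle
        exact absurd (le_bot_iff.1 hdimle) (by norm_cast)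
      | coe D =>
        norm_cast at hdimle ⊢
        simpa using hdimle
    have hreg : IsRegularLocalRing (R ⧸ Ideal.span {x}) :=
      .of_spanFinrank_maximalIdeal_le _ (le_trans (by exact_mod_cast (by omega)) hled)
    have hrank : (IsLocalRing.maximalIdeal (R ⧸ Ideal.span {x})).spanFinrank = d := by
      refine le_antisymm (by omega) ?_
      rw [← IsRegularLocalRing.spanFinrank_maximalIdeal] at hled
      exact_mod_cast hled
    have hdom := ih _ hrank
    have hprime : (Ideal.span {x}).IsPrime := Ideal.Quotient.isDomain_iff_prime _ |>.1 hdom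
    obtain ⟨P, hP, hPx⟩ := Ideal.exists_minimalPrimes_le (I := ⊥) (J := Ideal.span {x}) bot_le
    have hPp := hP.1.1
    have hP0 : P = ⊥ := by
      refine Submodule.eq_bot_of_le_smul_of_le_jacobson_bot m P
        (IsNoetherian.noetherian _) ?_ (IsLocalRing.maximalIdeal_le_jacobson _)
      intro y hy
      obtain ⟨z, rfl⟩ := Ideal.mem_span_singleton'.1 (hPx hy)
      rw [mul_comm]
      exact Ideal.mul_mem_mul hxm ((hPp.mem_or_mem hy).resolve_right (hxmin P hP))
    rw [hP0] at hPp
    exact IsDomain.of_bot_isPrime R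

theorem IsRegularRing.isReduced (R : Type*) [CommRing R] [IsRegularRing R] : IsReduced R := by
  refine isReduced_ofLocalizationMaximal R fun P hP => ?_
  have := IsRegularLocalRing.isDomain (Localization.AtPrime P)
  infer_instance

/-! ### Exchange and transport of decompositions -/

section Lattice

variable {R M : Type*} [CommRing R] [AddCommGroup M] [Module R M]

/-- A finite family of submodules intersecting irredundantly in `N` has at most as many members
as any family of irreducible submodules intersecting in `N`. -/
theorem Submodule.card_le_card_of_irredundant {N : Submodule R M}
    {t : Finset (Submodule R M)} (htN : t.inf id = N)
    (hirr : ∀ s : Finset (Submodule R M), s ⊂ t → s.inf id ≠ N)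
    (S : Finset (Submodule R M)) (hS : ∀ J ∈ S, J ∈ t ∨ InfIrred J) (hSN : S.inf id = N) :
    t.card ≤ S.card := by
  classical
  induction hn : (S \ t).card using Nat.strong_induction_on generalizing S with
  | _ n ih =>
    by_cases hSt : S ⊆ t
    · rcases hSt.eq_or_ssubset with rfl | h
      · exact le_rfl
      · exact absurd hSN (hirr S h)
    · obtain ⟨x, hxS, hxt⟩ := Finset.not_subset.1 hSt
      have hxc : x ⊓ (S.erase x).inf id = N := by
        rw [← hSN, ← Finset.insert_erase hxS, Finset.inf_insert]
        simp
      obtain ⟨y, hy, hyN⟩ :=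
        Submodule.exists_inf_eq_of_infIrred ((hS x hxS).resolve_left hxt) hxc htN
      have hcard : (insert y (S.erase x)).card ≤ S.card := by
        refine (Finset.card_insert_le _ _).trans ?_
        rw [Finset.card_erase_add_one hxS]
      refine (ih _ ?_ (insert y (S.erase x)) ?_ ?_ rfl).trans hcard
      · rw [← hn]
        refine Finset.card_lt_card (Finset.ssubset_iff_of_subset ?_ |>.2 ⟨x, ?_, ?_⟩)
        · intro J hJ
          simp only [Finset.mem_sdiff, Finset.mem_insert, Finset.mem_erase] at hJ ⊢
          obtain ⟨rfl | hJ, hJt⟩ := hJ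
          · exact absurd hy hJt
          · exact ⟨hJ.2, hJt⟩
        · simp [hxS, hxt]
        · simp only [Finset.mem_sdiff, Finset.mem_insert, Finset.mem_erase]
          rintro ⟨rfl | h, -⟩
          · exact hxt hy
          · exact h.1 rfl
      · intro J hJ
        rcases Finset.mem_insert.1 hJ with rfl | hJ
        · exact .inl hy
        · exact hS J (Finset.mem_of_mem_erase hJ)
      · rw [Finset.inf_insert]
        exact hyN

theorem Submodule.IsIrredundantIrreducibleDecomposition.inf_erase_ne [DecidableEq (Submodule R M)]
    {N : Submodule R M} {t : Finset (Submodule R M)}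
    (ht : N.IsIrredundantIrreducibleDecomposition t) {J : Submodule R M} (hJ : J ∈ t) :
    (t.erase J).inf id ≠ N :=
  ht.irredundant _ (Finset.erase_ssubset hJ)

theorem Submodule.exists_decomposition_card_eq_reducibilityIndex {N : Submodule R M}
    (h : N.reducibilityIndex ≠ 0) :
    ∃ t : Finset (Submodule R M), N.IsIrredundantIrreducibleDecomposition t ∧
      t.card = N.reducibilityIndex :=
  Nat.sInf_mem (Nat.nonempty_of_pos_sInf (Nat.pos_of_ne_zero h))

variable {M' : Type*} [AddCommGroup M'] [Module R M']

theorem InfIrred.orderIso {α β : Type*} [SemilatticeInf α] [SemilatticeInf β] (e : α ≃o β)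
    {a : α} (ha : InfIrred a) : InfIrred (e a) := by
  refine ⟨fun h => ha.1 ((e.isMax_apply).1 h), fun b c hbc => ?_⟩
  have h : e.symm b ⊓ e.symm c = a := by rw [← map_inf, hbc, e.symm_apply_apply]
  exact (ha.2 h).imp (fun h => by rw [← h, e.apply_symm_apply])
    fun h => by rw [← h, e.apply_symm_apply]

theorem Submodule.IsIrredundantIrreducibleDecomposition.map_orderIso
    (e : Submodule R M ≃o Submodule R M') {N : Submodule R M} {t : Finset (Submodule R M)}
    (ht : N.IsIrredundantIrreducibleDecomposition t) :
    (e N).IsIrredundantIrreducibleDecomposition (t.map e.toEquiv.toEmbedding) := by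
  have hinf : ∀ s : Finset (Submodule R M),
      (s.map e.toEquiv.toEmbedding).inf id = e (s.inf id) := fun s => by
    rw [Finset.inf_map, map_finset_inf]
    rfl
  refine ⟨?_, ?_, ?_⟩
  · intro J hJ
    obtain ⟨K, hK, rfl⟩ := Finset.mem_map.1 hJ
    exact (ht.irreducible K hK).orderIso e
  · rw [hinf, ht.inf_eq]
  · intro s hs
    obtain ⟨s, hst, rfl⟩ := Finset.subset_map_iff.1 hs.1
    rw [hinf]
    exact fun h => ht.irredundant s (Finset.map_ssubset_map.1 hs) (e.injective h)

theorem Submodule.IsIrredundantIrreducibleDecomposition.map_linearEquiv (e : M ≃ₗ[R] M')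
    {t : Finset (Submodule R M)}
    (ht : (⊥ : Submodule R M).IsIrredundantIrreducibleDecomposition t) :
    (⊥ : Submodule R M').IsIrredundantIrreducibleDecomposition
      (t.map (Submodule.orderIsoMapComap e).toEquiv.toEmbedding) := by
  have h := ht.map_orderIso (Submodule.orderIsoMapComap e)
  rwa [(Submodule.orderIsoMapComap e).map_bot] at h

theorem LinearEquiv.reducibilityIndex_eq (e : M ≃ₗ[R] M') :
    Module.reducibilityIndex R M = Module.reducibilityIndex R M' := by
  refine congrArg sInf (Set.ext fun n => ⟨?_, ?_⟩)
  · rintro ⟨t, ht, rfl⟩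
    exact ⟨_, ht.map_linearEquiv e, Finset.card_map _⟩
  · rintro ⟨t, ht, rfl⟩
    exact ⟨_, ht.map_linearEquiv e.symm, Finset.card_map _⟩

end Lattice

/-! ### Flat base change of submodules and of essential extensions -/

namespace Submodule
section BaseChange

variable {R M M' : Type*} (S : Type*) [CommRing R] [CommRing S] [Algebra R S]
  [AddCommGroup M] [Module R M] [AddCommGroup M'] [Module R M']

theorem baseChange_map (f : M →ₗ[R] M') (N : Submodule R M) :
    (N.map f).baseChange S = (N.baseChange S).map (f.baseChange S) := by
  rw [baseChange_eq_span, baseChange_eq_span, map_span]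
  congr 1
  ext x
  simp

theorem baseChange_ker [Module.Flat R S] (f : M →ₗ[R] M') :
    (LinearMap.ker f).baseChange S = LinearMap.ker (f.baseChange S) :=
  (Module.Flat.ker_lTensor_eq S S f).symm

theorem baseChange_comap [Module.Flat R S] (f : M →ₗ[R] M') (N : Submodule R M') :
    (N.comap f).baseChange S = (N.baseChange S).comap (f.baseChange S) := by
  conv_rhs => rw [← N.ker_mkQ]
  rw [baseChange_ker, ← LinearMap.ker_comp, ← LinearMap.baseChange_comp, ← baseChange_ker,
    LinearMap.ker_comp, ker_mkQ]

theorem baseChange_inf [Module.Flat R S] (N N' : Submodule R M) :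
    (N ⊓ N').baseChange S = N.baseChange S ⊓ N'.baseChange S := by
  rw [← map_comap_subtype, baseChange_map, baseChange_comap, map_comap_eq]
  rfl

theorem baseChange_finsetInf [Module.Flat R S] {ι : Type*} (s : Finset ι)
    (f : ι → Submodule R M) :
    (s.inf f).baseChange S = s.inf fun i => (f i).baseChange S := by
  classical
  induction s using Finset.induction_on with
  | empty => simp
  | insert i s hi ih => rw [Finset.inf_insert, Finset.inf_insert, baseChange_inf, ih]

variable {S}

theorem baseChange_comap_smul [Module.Flat R S] (a : R) (N : Submodule R M) :
    (N.comap (LinearMap.lsmul R M a)).baseChange S =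
      (N.baseChange S).comap (LinearMap.lsmul S (S ⊗[R] M) (algebraMap R S a)) := by
  rw [baseChange_comap]
  congr 1
  ext x
  simp

/-- The preimage of N under r ↦ rb is p, and flat base change commutes with preimages. -/
theorem tmul_mem_baseChange_iff [Module.Flat R S] {N : Submodule R M} {b : M} {p : Ideal R}
    (hp : N.colon {b} = p) (σ : S) :
    σ ⊗ₜ[R] b ∈ N.baseChange S ↔ σ ∈ p.map (algebraMap R S) := by
  have hc : N.comap (LinearMap.toSpanSingleton R M b) = p := by
    rw [← hp]
    ext r
    simp [mem_colon_singleton]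
  have h1 : σ ⊗ₜ[R] b ∈ N.baseChange S ↔ σ ⊗ₜ[R] (1 : R) ∈ baseChange S p := by
    rw [← hc, baseChange_comap, mem_comap]
    simp
  have h2 : (baseChange S p).map (TensorProduct.AlgebraTensorModule.rid R S S).toLinearMap =
      p.map (algebraMap R S) := by
    rw [baseChange_eq_span, map_span, Ideal.map, Ideal.span]
    congr 1
    ext x
    simp [Algebra.algebraMap_eq_smul_one]
  rw [h1, ← h2, mem_map_equiv]
  simp

/-- An essential extension of `N` stays essential under flat base change. -/
theorem baseChange_lt_inf_of_essential [IsNoetherianRing R] [Module.Finite R M] [Module.Flat R S]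
    {N C : Submodule R M} (hNC : N ≤ C) (hess : ∀ K, N < K → N < K ⊓ C)
    {K : Submodule S (S ⊗[R] M)} (hK : N.baseChange S < K) :
    N.baseChange S < K ⊓ C.baseChange S := by
  have := isNoetherian_of_isNoetherianRing_of_finite R M
  -- Noetherian induction from the top: C is enlarged to C + Ry, where C : y = p is an associated
  -- prime of M/C.
  induction C using WellFoundedGT.induction with
  | _ C ih =>
    by_cases hC : C = ⊤
    · simpa [hC] using hK
    have : Nontrivial (M ⧸ C) := Quotient.nontrivial_iff.2 hC
    obtain ⟨p, hp⟩ := associatedPrimes.nonempty R (M ⧸ C)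
    obtain ⟨hpp, y, hy⟩ := (isAssociatedPrime_iff).1 hp
    obtain ⟨y, rfl⟩ := mkQ_surjective C y
    have hpy : ∀ {r : R}, r ∈ p ↔ r • y ∈ C := by
      intro r
      rw [hy, mem_colon_singleton, mem_bot, ← map_smul, mkQ_apply, Quotient.mk_eq_zero]
    have hyC : y ∉ C := fun h => hpp.ne_top ((Ideal.eq_top_iff_one p).2 (hpy.2 (by simpa)))
    have hlt : C < C ⊔ span R {y} := by
      simpa using hyC
    have h1 := ih _ hlt (hNC.trans hlt.le) fun K hK =>
      (hess K hK).trans_le (inf_le_inf_left K hlt.le)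
    obtain ⟨-, x, hx, hxN⟩ := SetLike.lt_iff_le_and_exists.1 h1
    refine lt_of_le_of_ne (le_inf hK.le (baseChange_mono S hNC)) fun heq => hxN ?_
    have hax : ∀ a ∈ p, algebraMap R S a • x ∈ N.baseChange S := by
      intro a ha
      rw [heq]
      refine ⟨smul_mem _ _ hx.1, ?_⟩
      have hle : C ⊔ span R {y} ≤ C.comap (LinearMap.lsmul R M a) := by
        refine sup_le (fun c hc => C.smul_mem a hc) ?_
        rw [span_singleton_le_iff_mem]
        exact hpy.1 ha
      have := baseChange_mono S hle hx.2
      rwa [baseChange_comap_smul] at this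
    obtain ⟨s, hs⟩ := IsNoetherian.noetherian p
    -- As p is finitely generated, being killed by p modulo N is a finite intersection, which
    -- commutes with base change. It remains to show over R that (N : p) ∩ (C + Ry) lies in C.
    have hmem : x ∈ ((s.inf fun a => N.comap (LinearMap.lsmul R M a)) ⊓
        (C ⊔ span R {y})).baseChange S := by
      rw [baseChange_inf, baseChange_finsetInf]
      refine ⟨?_, hx.2⟩
      rw [SetLike.mem_coe, mem_finsetInf]
      intro a ha
      rw [baseChange_comap_smul]
      exact hax a (hs ▸ subset_span ha)
    rw [heq]
    refine ⟨hx.1, baseChange_mono S ?_ hmem⟩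
    rintro z ⟨hz, hzC⟩
    obtain ⟨c, hc, w, hw, rfl⟩ := mem_sup.1 hzC
    obtain ⟨r, rfl⟩ := mem_span_singleton.1 hw
    refine C.add_mem hc ?_
    -- Here r ∉ p. Essentiality gives qz in C, up to N, with qz ∉ N; then qr ∈ p forces q ∈ p,
    -- whence qz ∈ N.
    by_contra hrC
    set z := c + r • y with hzdef
    have hpz : ∀ a ∈ p, a • z ∈ N := by
      have hle : p ≤ N.colon {z} := by
        rw [← hs, span_le]
        intro a ha
        rw [SetLike.mem_coe, mem_colon_singleton]
        exact (mem_finsetInf.1 hz a ha : _)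
      exact fun a ha => mem_colon_singleton.1 (hle ha)
    have hzC' : z ∉ C := fun h => hrC ((C.add_mem_iff_right hc).1 h)
    have hNz : N < N ⊔ span R {z} := by
      simpa using fun h => hzC' (hNC h)
    obtain ⟨-, k, hk, hkN⟩ := SetLike.lt_iff_le_and_exists.1 (hess _ hNz)
    obtain ⟨n, hn, w, hw, rfl⟩ := mem_sup.1 hk.1
    obtain ⟨q, rfl⟩ := mem_span_singleton.1 hw
    refine hkN (N.add_mem hn (hpz q ?_))
    have h2 : q • z ∈ C := (C.add_mem_iff_right (hNC hn)).1 hk.2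
    have h3 : (q * r) • y ∈ C := by
      rw [hzdef, smul_add, smul_smul] at h2
      exact (C.add_mem_iff_right (C.smul_mem q hc)).1 h2
    exact (hpp.mem_or_mem (hpy.2 h3)).resolve_right fun h => hrC (hpy.1 h)

end BaseChange
end Submodule

/-! ### Irreducibility and the index under faithfully flat base change -/

namespace Submodule
section ReducibilityIndexBaseChange

variable {R M S : Type*} [CommRing R] [CommRing S] [Algebra R S] [AddCommGroup M] [Module R M]

theorem lt_inf_of_infIrred {N C K : Submodule R M} (hN : InfIrred N) (hC : N < C) (hK : N < K) :
    N < K ⊓ C :=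
  lt_of_le_of_ne (le_inf hK.le hC.le) fun h => (hN.2 h.symm).elim hK.ne' hC.ne'

theorem tmul_mem_baseChange_one_iff [Module.FaithfullyFlat R S] {N : Submodule R M} {b : M} :
    (1 : S) ⊗ₜ[R] b ∈ N.baseChange S ↔ b ∈ N := by
  rw [← span_singleton_le_iff_mem b, ← baseChange_le_iff (A := S), baseChange_span,
    Set.image_singleton, span_singleton_le_iff_mem]
  rfl

theorem exists_tmul_mem_of_lt_inf {N : Submodule R M} {b : M} {K : Submodule S (S ⊗[R] M)}
    (hK : N.baseChange S < K ⊓ (N ⊔ span R {b}).baseChange S) :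
    ∃ σ : S, σ ⊗ₜ[R] b ∈ K ∧ σ ⊗ₜ[R] b ∉ N.baseChange S := by
  obtain ⟨hle, x, ⟨hxK, hx⟩, hxN⟩ := SetLike.lt_iff_le_and_exists.1 hK
  have hsup : (N ⊔ span R {b}).baseChange S ≤ N.baseChange S ⊔ span S {(1 : S) ⊗ₜ[R] b} := by
    rw [baseChange_eq_span, span_le]
    rintro _ ⟨m, hm, rfl⟩
    obtain ⟨n, hn, w, hw, rfl⟩ := mem_sup.1 hm
    obtain ⟨r, rfl⟩ := mem_span_singleton.1 hw
    rw [map_add]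
    refine add_mem (mem_sup_left (tmul_mem_baseChange_of_mem 1 hn)) (mem_sup_right ?_)
    rw [map_smul, TensorProduct.mk_apply]
    exact (span S _).smul_of_tower_mem r (mem_span_singleton_self _)
  obtain ⟨n, hn, w, hw, rfl⟩ := mem_sup.1 (hsup hx)
  obtain ⟨σ, rfl⟩ := mem_span_singleton.1 hw
  rw [TensorProduct.smul_tmul', smul_eq_mul, mul_one] at hxK hxN
  exact ⟨σ, ((K.add_mem_iff_right (hle hn).1).1 hxK), fun h => hxN (add_mem hn h)⟩

variable [IsNoetherianRing R] [Module.Finite R M] [Module.FaithfullyFlat R S]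

/-- By essentiality, two strictly larger submodules contain some σ ⊗ b and τ ⊗ b with σ, τ ∉ pS.
Then στ ⊗ b lies in both, and στ ∉ pS. -/
theorem infIrred_baseChange {N : Submodule R M} (hN : InfIrred N) {b : M} {p : Ideal R}
    (hp : N.colon {b} = p) (hpS : (p.map (algebraMap R S)).IsPrime) :
    InfIrred (N.baseChange S) := by
  have hbN : (1 : S) ⊗ₜ[R] b ∉ N.baseChange S := fun h =>
    hpS.ne_top ((Ideal.eq_top_iff_one _).2 ((tmul_mem_baseChange_iff hp 1).1 h))
  refine ⟨fun h => hbN ?_, fun J J' hJ => ?_⟩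
  · rw [isMax_iff_eq_top.1 h]
    exact mem_top
  · by_contra! hne
    have hJ1 : N.baseChange S < J := lt_of_le_of_ne (hJ ▸ inf_le_left) hne.1.symm
    have hJ2 : N.baseChange S < J' := lt_of_le_of_ne (hJ ▸ inf_le_right) hne.2.symm
    have hb : b ∉ N := fun h => hbN (tmul_mem_baseChange_of_mem 1 h)
    have hC : N < N ⊔ span R {b} := by simpa using hb
    have hess := fun K hK => lt_inf_of_infIrred (K := K) hN hC hK
    obtain ⟨σ, hσ, hσN⟩ :=
      exists_tmul_mem_of_lt_inf (baseChange_lt_inf_of_essential hC.le hess hJ1)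
    obtain ⟨τ, hτ, hτN⟩ :=
      exists_tmul_mem_of_lt_inf (baseChange_lt_inf_of_essential hC.le hess hJ2)
    rw [tmul_mem_baseChange_iff hp] at hσN hτN
    have hmem : (σ * τ) ⊗ₜ[R] b ∈ N.baseChange S := by
      rw [← hJ]
      refine ⟨?_, ?_⟩
      · rw [mul_comm, ← smul_eq_mul, ← TensorProduct.smul_tmul']
        exact J.smul_mem τ hσ
      · rw [← smul_eq_mul, ← TensorProduct.smul_tmul']
        exact J'.smul_mem σ hτ
    rw [tmul_mem_baseChange_iff hp] at hmem
    exact (hpS.mem_or_mem hmem).elim hσN hτN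

omit [IsNoetherianRing R] [Module.Finite R M] in
-- If στ ∈ pS with neither factor in pS, irreducibility makes the ideals generated by σ and τ in
-- S/pS meet in a nonzero cτ = dσ, whose square vanishes, against radicality.
theorem isPrime_map_of_infIrred_baseChange {N : Submodule R M} {b : M} {p : Ideal R}
    (hp : N.colon {b} = p) (hb : b ∉ N) (hrad : (p.map (algebraMap R S)).IsRadical)
    (hN : InfIrred (N.baseChange S)) : (p.map (algebraMap R S)).IsPrime := by
  refine ⟨fun h => hb ?_, fun {σ τ} hστ => ?_⟩
  · rw [← tmul_mem_baseChange_one_iff (S := S), tmul_mem_baseChange_iff hp, h]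
    exact mem_top
  · by_contra! hne
    have hlt : ∀ {σ : S}, σ ∉ p.map (algebraMap R S) →
        N.baseChange S < N.baseChange S ⊔ span S {σ ⊗ₜ[R] b} := fun {σ} hσ => by
      rw [← tmul_mem_baseChange_iff hp] at hσ
      simpa using hσ
    obtain ⟨-, x, ⟨hx1, hx2⟩, hxN⟩ :=
      SetLike.lt_iff_le_and_exists.1 (lt_inf_of_infIrred hN (hlt hne.1) (hlt hne.2))
    obtain ⟨n, hn, w, hw, rfl⟩ := mem_sup.1 hx1
    obtain ⟨c, rfl⟩ := mem_span_singleton.1 hw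
    obtain ⟨n', hn', w', hw', he⟩ := mem_sup.1 hx2
    obtain ⟨d, rfl⟩ := mem_span_singleton.1 hw'
    rw [TensorProduct.smul_tmul', smul_eq_mul] at he hxN
    rw [TensorProduct.smul_tmul', smul_eq_mul] at he
    have hd : (c * τ - d * σ) ⊗ₜ[R] b ∈ N.baseChange S := by
      have : (c * τ - d * σ) ⊗ₜ[R] b = n' - n := by
        rw [TensorProduct.sub_tmul, sub_eq_sub_iff_add_eq_add, add_comm, ← he, add_comm]
      rw [this]
      exact sub_mem hn' hn
    rw [tmul_mem_baseChange_iff hp] at hd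
    refine hxN (add_mem hn ((tmul_mem_baseChange_iff hp _).2 (hrad ⟨2, ?_⟩)))
    have : (c * τ) ^ 2 = c * τ * (c * τ - d * σ) + c * d * (σ * τ) := by ring
    rw [this]
    exact add_mem (Ideal.mul_mem_left _ _ hd) (Ideal.mul_mem_left _ _ hστ)

omit [Module.Finite R M] [Module.FaithfullyFlat R S] in
-- The intersection c of the other members is nonzero and meets N in 0, so N : b = 0 : b for b in c.
theorem IsIrredundantIrreducibleDecomposition.exists_colon_eq {t : Finset (Submodule R M)}
    (ht : (⊥ : Submodule R M).IsIrredundantIrreducibleDecomposition t) {N : Submodule R M}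
    (hN : N ∈ t) : ∃ b : M, N.colon {b} ∈ associatedPrimes R M := by
  classical
  set c := (t.erase N).inf id with hc
  have hNc : N ⊓ c = ⊥ := by
    rw [← ht.inf_eq, ← Finset.insert_erase hN, Finset.inf_insert]
    simp [hc]
  have : Nontrivial c := nontrivial_iff_ne_bot.2 (ht.inf_erase_ne hN)
  obtain ⟨p, hp⟩ := associatedPrimes.nonempty R c
  obtain ⟨hpp, b, hb⟩ := isAssociatedPrime_iff.1 hp
  refine ⟨b, ?_⟩
  have h : N.colon {(b : M)} = p := by
    rw [hb]
    ext r
    rw [mem_colon_singleton, mem_colon_singleton, mem_bot, ← coe_eq_zero, coe_smul]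
    refine ⟨fun h => ?_, fun h => h ▸ N.zero_mem⟩
    rw [← mem_bot R, ← hNc]
    exact ⟨h, c.smul_mem r b.2⟩
  rw [h]
  exact associatedPrimes.subset_of_injective c.injective_subtype hp

theorem IsIrredundantIrreducibleDecomposition.baseChange {t : Finset (Submodule R M)}
    (ht : (⊥ : Submodule R M).IsIrredundantIrreducibleDecomposition t)
    (h : ∀ p ∈ associatedPrimes R M, (p.map (algebraMap R S)).IsPrime) :
    (⊥ : Submodule S (S ⊗[R] M)).IsIrredundantIrreducibleDecomposition
      (t.map (baseChangeOrderEmbedding R M S).toEmbedding) := by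
  have hinf : ∀ s : Finset (Submodule R M),
      (s.map (baseChangeOrderEmbedding R M S).toEmbedding).inf id = (s.inf id).baseChange S :=
    fun s => by
      rw [Finset.inf_map, baseChange_finsetInf]
      rfl
  refine ⟨?_, ?_, ?_⟩
  · intro J hJ
    obtain ⟨N, hN, rfl⟩ := Finset.mem_map.1 hJ
    obtain ⟨b, hb⟩ := ht.exists_colon_eq hN
    exact infIrred_baseChange (ht.irreducible N hN) rfl (h _ hb)
  · rw [hinf, ht.inf_eq, baseChange_bot]
  · intro s hs
    obtain ⟨s, hst, rfl⟩ := Finset.subset_map_iff.1 hs.1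
    rw [hinf, ← baseChange_bot S]
    exact fun h => ht.irredundant s (Finset.map_ssubset_map.1 hs) (baseChange_injective h)

omit [Module.Finite R M] [Module.FaithfullyFlat R S] in
-- If p = 0 : b, then p is the intersection of the ideals N : b, and a prime containing a finite
-- intersection contains a member.
theorem IsIrredundantIrreducibleDecomposition.exists_colon_eq_of_mem_associatedPrimes
    {t : Finset (Submodule R M)}
    (ht : (⊥ : Submodule R M).IsIrredundantIrreducibleDecomposition t) {p : Ideal R}
    (hp : p ∈ associatedPrimes R M) : ∃ N ∈ t, ∃ b ∉ N, N.colon {b} = p := by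
  obtain ⟨hpp, b, hb⟩ := isAssociatedPrime_iff.1 hp
  have hle : t.inf (fun N => N.colon {b}) ≤ p := by
    intro r hr
    rw [hb, mem_colon_singleton, ← ht.inf_eq, mem_finsetInf]
    exact fun N hN => mem_colon_singleton.1 (mem_finsetInf.1 hr N hN)
  obtain ⟨N, hN, hNp⟩ := hpp.inf_le'.1 hle
  have heq : N.colon {b} = p := by
    refine le_antisymm hNp fun r hr => ?_
    rw [hb, mem_colon_singleton, mem_bot] at hr
    rw [mem_colon_singleton, hr]
    exact N.zero_mem
  refine ⟨N, hN, b, fun h => hpp.ne_top ?_, heq⟩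
  rw [← heq, Ideal.eq_top_iff_one, mem_colon_singleton, one_smul]
  exact h

theorem IsIrredundantIrreducibleDecomposition.infIrred_baseChange_of_card_le
    {t : Finset (Submodule R M)}
    (ht : (⊥ : Submodule R M).IsIrredundantIrreducibleDecomposition t)
    {T : Finset (Submodule S (S ⊗[R] M))} (hT : ∀ J ∈ T, InfIrred J) (hT0 : T.inf id = ⊥)
    (hcard : T.card ≤ t.card) {N : Submodule R M} (hN : N ∈ t) :
    InfIrred (N.baseChange S) := by
  classical
  by_contra hirr
  rw [not_infIrred, isMax_iff_eq_top, ← baseChange_top S, baseChange_inj] at hirr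
  obtain ⟨J, J', hJJ, hJ, hJ'⟩ := hirr.resolve_left (ht.irreducible N hN).ne_top
  set c := (t.erase N).inf id with hc
  have hNc : N ⊓ c = ⊥ := by
    rw [← ht.inf_eq, ← Finset.insert_erase hN, Finset.inf_insert]
    simp [hc]
  have hc0 : c ≠ ⊥ := ht.inf_erase_ne hN
  have hNlt : N < N ⊔ c := by
    rw [left_lt_sup]
    exact fun h => hc0 (by rwa [inf_eq_right.2 h] at hNc)
  have hsup : (N ⊔ c).baseChange S ≤ N.baseChange S ⊔ c.baseChange S := by
    rw [baseChange_eq_span, span_le]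
    rintro _ ⟨m, hm, rfl⟩
    obtain ⟨n, hn, w, hw, rfl⟩ := mem_sup.1 hm
    rw [map_add]
    exact add_mem (mem_sup_left (tmul_mem_baseChange_of_mem 1 hn))
      (mem_sup_right (tmul_mem_baseChange_of_mem 1 hw))
  -- N + c is essential over N, and stays so over S; the modular law turns this into meeting S ⊗ c.
  -- Hence neither J nor J' can be dropped.
  have hmeet : ∀ K, N.baseChange S < K → K ⊓ c.baseChange S ≠ ⊥ := by
    intro K hK h0
    have h1 := baseChange_lt_inf_of_essential hNlt.le
      (fun L hL => lt_inf_of_infIrred (ht.irreducible N hN) hNlt hL) hK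
    have h2 : K ⊓ (N ⊔ c).baseChange S ≤ N.baseChange S := by
      calc K ⊓ (N ⊔ c).baseChange S ≤ K ⊓ (N.baseChange S ⊔ c.baseChange S) :=
            inf_le_inf_left K hsup
        _ = (N.baseChange S ⊔ c.baseChange S) ⊓ K := inf_comm _ _
        _ = N.baseChange S ⊔ c.baseChange S ⊓ K := sup_inf_assoc_of_le _ hK.le
        _ = N.baseChange S := by rw [inf_comm, h0, sup_bot_eq]
    exact h1.not_ge h2
  set F := (t.erase N).map (baseChangeOrderEmbedding R M S).toEmbedding with hF
  have hFinf : F.inf id = c.baseChange S := by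
    rw [hF, Finset.inf_map, hc, baseChange_finsetInf]
    rfl
  have hJJc : J ⊓ J' ⊓ c.baseChange S = ⊥ := by
    rw [hJJ, ← baseChange_inf, hNc, baseChange_bot]
  have hJF : J ∉ F := fun h => by
    have : c.baseChange S ≤ J := hFinf ▸ Finset.inf_le (f := id) h
    refine hmeet J' hJ' ?_
    rw [← hJJc, inf_comm J, inf_assoc, inf_eq_right.2 this]
  have hJF' : J' ∉ F := fun h => by
    have : c.baseChange S ≤ J' := hFinf ▸ Finset.inf_le (f := id) h
    refine hmeet J hJ ?_
    rw [← hJJc, inf_assoc, inf_eq_right.2 this]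
  have hne : J ≠ J' := fun h => by
    rw [← h, inf_idem] at hJJ
    exact hJ.ne' hJJ
  have hFcard : (insert J (insert J' F)).card = t.card + 1 := by
    rw [Finset.card_insert_of_notMem (by simp [hne, hJF]), Finset.card_insert_of_notMem hJF', hF,
      Finset.card_map, Finset.card_erase_add_one hN]
  have hle := card_le_card_of_irredundant (N := ⊥) (t := insert J (insert J' F)) ?_ ?_ T
    (fun K hK => .inr (hT K hK)) hT0
  · omega
  · rw [Finset.inf_insert, Finset.inf_insert, hFinf, ← inf_assoc]
    exact hJJc
  · intro s hs hs0
    obtain ⟨L, hL, hLs⟩ := Finset.exists_of_ssubset hs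
    have hle : s ⊆ (insert J (insert J' F)).erase L := fun x hx =>
      Finset.mem_erase.2 ⟨fun h => hLs (h ▸ hx), hs.1 hx⟩
    have hbot : ((insert J (insert J' F)).erase L).inf id = ⊥ :=
      le_bot_iff.1 (hs0 ▸ Finset.inf_mono hle)
    rcases Finset.mem_insert.1 hL with rfl | hL
    · rw [Finset.erase_insert (by simp [hne, hJF]), Finset.inf_insert, hFinf] at hbot
      exact hmeet J' hJ' hbot
    rcases Finset.mem_insert.1 hL with rfl | hLF
    · rw [Finset.erase_insert_of_ne hne, Finset.erase_insert hJF', Finset.inf_insert, hFinf]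
        at hbot
      exact hmeet J hJ hbot
    · obtain ⟨Q, hQ, rfl⟩ := Finset.mem_map.1 hLF
      have hQt := Finset.mem_of_mem_erase hQ
      -- Dropping another member Q is also impossible: J and J' contain S ⊗ N, so 0 would already be
      -- the intersection of `t` without Q.
      refine ht.inf_erase_ne hQt ?_
      rw [← baseChange_inj (A := S), baseChange_bot, eq_bot_iff, ← hbot]
      refine Finset.le_inf fun K hK => ?_
      obtain ⟨hKQ, hK⟩ := Finset.mem_erase.1 hK
      have hNle : ((t.erase Q).inf id).baseChange S ≤ N.baseChange S :=
        baseChange_mono S (Finset.inf_le (f := id)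
          (Finset.mem_erase.2 ⟨(Finset.ne_of_mem_erase hQ).symm, hN⟩))
      rcases Finset.mem_insert.1 hK with rfl | hK
      · exact hNle.trans hJ.le
      rcases Finset.mem_insert.1 hK with rfl | hK
      · exact hNle.trans hJ'.le
      · obtain ⟨P, hP, rfl⟩ := Finset.mem_map.1 hK
        refine baseChange_mono S (Finset.inf_le (f := id) (Finset.mem_erase.2 ⟨?_, ?_⟩))
        · rintro rfl
          exact hKQ rfl
        · exact Finset.mem_of_mem_erase hP

end ReducibilityIndexBaseChange
end Submodule

/-- Let `S` be a faithfully flat algebra over a Noetherian ring `R` such that the associated primes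
of `M` generate radical ideals of `S`. Then the reducibility index of `M` is preserved by base
change to `S` if and only if the associated primes of `M` generate prime ideals of `S`. -/
theorem Module.reducibilityIndex_eq_baseChange_iff {R M S : Type*} [CommRing R] [CommRing S]
    [Algebra R S] [AddCommGroup M] [Module R M] [IsNoetherianRing R] [Module.Finite R M]
    [Module.FaithfullyFlat R S]
    (hrad : ∀ p ∈ associatedPrimes R M, (p.map (algebraMap R S)).IsRadical) :
    Module.reducibilityIndex R M = Module.reducibilityIndex S (S ⊗[R] M) ↔
      ∀ p ∈ associatedPrimes R M, (p.map (algebraMap R S)).IsPrime := by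
  have := isNoetherian_of_isNoetherianRing_of_finite R M
  obtain ⟨t, ht⟩ := (⊥ : Submodule R M).exists_isIrredundantIrreducibleDecomposition
  have hcard : t.card = Module.reducibilityIndex R M := ht.card_eq_reducibilityIndex
  constructor
  · intro h p hp
    obtain ⟨N, hN, b, hb, hNb⟩ := ht.exists_colon_eq_of_mem_associatedPrimes hp
    -- S is not assumed Noetherian. The infimum of the empty set is 0, so a nonzero index certifies
    -- that a decomposition exists.
    have hpos : Module.reducibilityIndex S (S ⊗[R] M) ≠ 0 := by
      rw [← h, ← hcard]
      exact Finset.card_ne_zero_of_mem hN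
    obtain ⟨T, hT, hTc⟩ := Submodule.exists_decomposition_card_eq_reducibilityIndex hpos
    have hTt : T.card ≤ t.card := by
      rw [hcard, h, hTc]
      rfl
    exact Submodule.isPrime_map_of_infIrred_baseChange hNb hb (hrad p hp)
      (ht.infIrred_baseChange_of_card_le hT.irreducible hT.inf_eq hTt hN)
  · intro h
    rw [← hcard, ← Finset.card_map]
    exact (ht.baseChange h).card_eq_reducibilityIndex

/-! ### Reduced fibres and radical extended primes -/

theorem Algebra.IsGeometricallyRegular.isReduced {k : Type u} {A : Type v} [Field k] [CommRing A]
    [Algebra k A] (h : Algebra.IsGeometricallyRegular k A) : IsReduced A := by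
  have := h k
  have := IsRegularRing.isReduced (k ⊗[k] A)
  exact isReduced_of_injective (Algebra.TensorProduct.lid k A).symm
    (Algebra.TensorProduct.lid k A).symm.injective

/-- By flatness B/pB embeds in the fibre over p, which is reduced. -/
theorem Algebra.IsRegularHom.isRadical_map {A : Type u} {B : Type v} [CommRing A] [CommRing B]
    [Algebra A B] (h : Algebra.IsRegularHom A B) (p : Ideal A) [p.IsPrime] :
    (p.map (algebraMap A B)).IsRadical := by
  have := h.flat
  have := (h.geometricallyRegular p).isReduced
  have hred : IsReduced (B ⊗[A] p.ResidueField) :=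
    isReduced_of_injective (Algebra.TensorProduct.comm A B p.ResidueField)
      (Algebra.TensorProduct.comm A B p.ResidueField).injective
  have hp : (⊥ : Submodule A p.ResidueField).colon {(1 : p.ResidueField)} = p := by
    ext r
    rw [Submodule.mem_colon_singleton, Submodule.mem_bot, ← Algebra.algebraMap_eq_smul_one,
      Ideal.algebraMap_residueField_eq_zero]
  rintro x ⟨n, hx⟩
  rw [← Submodule.tmul_mem_baseChange_iff hp, Submodule.baseChange_bot, Submodule.mem_bot] at hx ⊢
  refine eq_zero_of_pow_eq_zero (n := n) ?_
  rw [Algebra.TensorProduct.tmul_pow, one_pow, hx]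

/-! ### Functoriality and faithful flatness of completion -/

namespace AdicCompletion

variable {R R' : Type*} [CommRing R] [CommRing R'] {I : Ideal R} {J : Ideal R'}

theorem factorPow_comp_quotientMap_evalₐ (f : R →+* R') (h : I ≤ J.comap f) {m n : ℕ}
    (hle : m ≤ n) :
    (Ideal.Quotient.factorPow J hle).comp ((Ideal.quotientMap (J ^ n) f
      ((Ideal.pow_right_mono h n).trans (Ideal.le_comap_pow f n))).comp (evalₐ I n : AdicCompletion I R →+* R ⧸ I ^ n)) =
    (Ideal.quotientMap (J ^ m) f
      ((Ideal.pow_right_mono h m).trans (Ideal.le_comap_pow f m))).comp (evalₐ I m : AdicCompletion I R →+* R ⧸ I ^ m) := by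
  ext x
  obtain ⟨x, rfl⟩ := mk_surjective I R x
  have hm := congrArg (Ideal.quotientMap (J ^ m) f
    ((Ideal.pow_right_mono h m).trans (Ideal.le_comap_pow f m))) (Ideal.mk_eq_mk I hle x)
  simpa using hm

/-- The map on completions of rings induced by a ring homomorphism. -/
noncomputable def mapRingHom (f : R →+* R') (h : I ≤ J.comap f) :
    AdicCompletion I R →+* AdicCompletion J R' :=
  liftRingHom J (fun n => (Ideal.quotientMap (J ^ n) f
      ((Ideal.pow_right_mono h n).trans (Ideal.le_comap_pow f n))).comp (evalₐ I n : AdicCompletion I R →+* R ⧸ I ^ n))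
    fun hle => factorPow_comp_quotientMap_evalₐ f h hle

theorem evalₐ_mapRingHom (f : R →+* R') (h : I ≤ J.comap f) (n : ℕ) (x : AdicCompletion I R) :
    evalₐ J n (mapRingHom f h x) = Ideal.quotientMap (J ^ n) f
      ((Ideal.pow_right_mono h n).trans (Ideal.le_comap_pow f n)) (evalₐ I n x) :=
  evalₐ_liftRingHom J _ (fun hle => factorPow_comp_quotientMap_evalₐ f h hle) n x

theorem mapRingHom_mapRingHom_of_leftInverse {f : R →+* R'} {g : R' →+* R}
    (hgf : g.comp f = RingHom.id R)
    (hf : I ≤ J.comap f) (hg : J ≤ I.comap g) (x : AdicCompletion I R) :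
    mapRingHom g hg (mapRingHom f hf x) = x := by
  refine ext_evalₐ fun n => ?_
  rw [evalₐ_mapRingHom, evalₐ_mapRingHom]
  obtain ⟨r, hr⟩ := Ideal.Quotient.mk_surjective (evalₐ I n x)
  rw [← hr, Ideal.quotientMap_mk, Ideal.quotientMap_mk]
  exact congrArg _ (RingHom.congr_fun hgf r)

/-- Needed because the formal fibre condition concerns the completion of the localization of R at
its maximal ideal, not of R itself. -/
theorem isRadical_map_of_ringEquiv (e : R ≃+* R') (hI : I ≤ J.comap (e : R →+* R'))
    (hJ : J ≤ I.comap (e.symm : R' →+* R)) {p : Ideal R}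
    [p.IsPrime]
    (h : ∀ q : Ideal R', q.IsPrime → (q.map (algebraMap R' (AdicCompletion J R'))).IsRadical) :
    (p.map (algebraMap R (AdicCompletion I R))).IsRadical := by
  replace h := h (p.map (e : R →+* R')) (Ideal.map_isPrime_of_equiv e)
  have h1 : (p.map (algebraMap R (AdicCompletion I R))).map (mapRingHom _ hI) =
      (p.map (e : R →+* R')).map (algebraMap R' (AdicCompletion J R')) := by
    rw [Ideal.map_map, Ideal.map_map]
    congr 1
  have h2 : ((p.map (e : R →+* R')).map (algebraMap R' (AdicCompletion J R'))).map
      (mapRingHom _ hJ) = p.map (algebraMap R (AdicCompletion I R)) := by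
    rw [← h1, Ideal.map_map]
    have hid : (mapRingHom _ hJ).comp (mapRingHom _ hI) = RingHom.id _ :=
      RingHom.ext fun x => mapRingHom_mapRingHom_of_leftInverse (by simp) hI hJ x
    rw [hid, Ideal.map_id]
  rintro x ⟨n, hx⟩
  have h3 : mapRingHom _ hI x ∈ _ := h ⟨n, by
    rw [← map_pow, ← h1]
    exact Ideal.mem_map_of_mem _ hx⟩
  rw [← h2, ← mapRingHom_mapRingHom_of_leftInverse (f := (e : R →+* R'))
    (g := (e.symm : R' →+* R)) (by simp) hI hJ x]
  exact Ideal.mem_map_of_mem _ h3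

theorem faithfullyFlat_of_isLocalRing [IsLocalRing R] [IsNoetherianRing R] :
    Module.FaithfullyFlat R (AdicCompletion (IsLocalRing.maximalIdeal R) R) where
  submodule_ne_top := by
    intro m hm htop
    obtain rfl := IsLocalRing.eq_maximalIdeal hm
    -- The extended maximal ideal dies in the residue field, where 1 does not.
    have hle : (IsLocalRing.maximalIdeal R • ⊤ : Submodule R _) ≤
        LinearMap.ker (evalOneₐ (IsLocalRing.maximalIdeal R)).toLinearMap := by
      refine Submodule.smul_le.2 fun r hr x _ => ?_
      obtain ⟨y, hy⟩ := Ideal.Quotient.mk_surjective (evalOneₐ (IsLocalRing.maximalIdeal R) x)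
      rw [LinearMap.mem_ker, map_smul, AlgHom.toLinearMap_apply, ← hy, Algebra.smul_def,
        Ideal.Quotient.algebraMap_eq, Ideal.Quotient.eq_zero_iff_mem.2 hr, zero_mul]
    have h1 := hle (htop.ge (Submodule.mem_top (x := 1)))
    rw [LinearMap.mem_ker, AlgHom.toLinearMap_apply, map_one] at h1
    exact one_ne_zero h1

end AdicCompletion

theorem HasGeometricallyRegularFormalFibers.isRadical_map {R : Type u} [CommRing R]
    [IsLocalRing R] (h : HasGeometricallyRegularFormalFibers R) (p : Ideal R) [p.IsPrime] :
    (p.map (algebraMap R (AdicCompletion (IsLocalRing.maximalIdeal R) R))).IsRadical := by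
  obtain ⟨e⟩ : Nonempty (R ≃+* Localization.AtPrime (IsLocalRing.maximalIdeal R)) :=
    ⟨(IsLocalization.atUnits R (IsLocalRing.maximalIdeal R).primeCompl
      (S := Localization.AtPrime (IsLocalRing.maximalIdeal R))
      (fun x hx => IsLocalRing.notMem_maximalIdeal.1 hx)).toRingEquiv⟩
  have hreg := h (IsLocalRing.maximalIdeal R)
  refine AdicCompletion.isRadical_map_of_ringEquiv e
    (J := IsLocalRing.maximalIdeal (Localization.AtPrime (IsLocalRing.maximalIdeal R))) ?_ ?_ ?_
  · rw [← Ideal.map_le_iff_le_comap]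
    exact (IsLocalRing.map_ringEquiv_maximalIdeal e).le
  · rw [← Ideal.map_le_iff_le_comap]
    exact (IsLocalRing.map_ringEquiv_maximalIdeal e.symm).le
  · exact fun q _ => hreg.isRadical_map q

theorem AdicCompletion.reducibilityIndex_eq_baseChange {R : Type u} {M : Type v} [CommRing R]
    [IsNoetherianRing R] [AddCommGroup M] [Module R M] [Module.Finite R M] (I : Ideal R) :
    Module.reducibilityIndex (AdicCompletion I R) (AdicCompletion I M) =
      Module.reducibilityIndex (AdicCompletion I R) (AdicCompletion I R ⊗[R] M) := by
  -- The comparison of tensor product and completion is applied to a copy of M in the universe of R.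
  have : Small.{u} M := Module.Finite.small.{u} R M
  let e : Shrink.{u} M ≃ₗ[R] M := Shrink.linearEquiv R M
  exact ((AdicCompletion.congr I e).symm.trans
    ((AdicCompletion.ofTensorProductEquivOfFiniteNoetherian I (Shrink.{u} M)).symm.trans
      (e.baseChange (A := AdicCompletion I R)))).reducibilityIndex_eq

theorem mainTheorem7 {R : Type u} {M : Type v} [CommRing R] [IsLocalRing R] [IsExcellentRing R]
    [AddCommGroup M] [Module R M] [Module.Finite R M] :
    Module.reducibilityIndex R M =
        Module.reducibilityIndex (AdicCompletion (IsLocalRing.maximalIdeal R) R)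
          (AdicCompletion (IsLocalRing.maximalIdeal R) M) ↔
      ∀ p ∈ associatedPrimes R M,
        (p.map (algebraMap R (AdicCompletion (IsLocalRing.maximalIdeal R) R))).IsPrime := by
  have : IsNoetherianRing R := IsExcellentRing.isNoetherianRing
  have := AdicCompletion.faithfullyFlat_of_isLocalRing (R := R)
  rw [AdicCompletion.reducibilityIndex_eq_baseChange]
  refine Module.reducibilityIndex_eq_baseChange_iff fun p hp => ?_
  have := hp.isPrime
  exact (IsExcellentRing.formalFibers (R := R)).isRadical_map p
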